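/- Composition is written in diagrammatic order. A \emph{Cartesian left additive category} is a category $\mathbb{X}$ with chosen finite products whose hom-sets are commutative monoids, with $x(f+g)=xf+xg$ and $x0=0$, and whose projections $\pi_i$ are additive: $(x+y)\pi_i=x\pi_i+y\pi_i$, $0\pi_i=0$. Put $\iota_0=\langle 1,0\rangle$, $\iota_1=\langle 0,1\rangle$ and $\mathsf{ex}=\langle\pi_0\times\pi_0,\pi_1\times\pi_1\rangle$. A \emph{differential combinator} on $\mathbb{X}$ sends each $f:A\to B$ to a map $\mathsf{D}[f]:A\times A\to B$ such that (1) $\mathsf{D}[f+g]=\mathsf{D}[f]+\mathsf{D}[g]$, $\mathsf{D}[0]=0$; (2) $\langle a,b+c\rangle\mathsf{D}[f]=\langle a,b\rangle\mathsf{D}[f]+\langle a,c\rangle\mathsf{D}[f]$, $\langle a,0\rangle\mathsf{D}[f]=0$; (3) $\mathsf{D}[1]=\pi_1$, $\mathsf{D}[\pi_0]=\pi_1\pi_0$, $\mathsf{D}[\pi_1]=\pi_1\pi_1$; (4) $\mathsf{D}[\langle f,g\rangle]=\langle\mathsf{D}[f],\mathsf{D}[g]\rangle$; (5) $\mathsf{D}[fg]=\langle\pi_0f,\mathsf{D}[f]\rangle\mathsf{D}[g]$;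 (6) $\langle\langle a,b\rangle,\langle 0,c\rangle\rangle\mathsf{D}[\mathsf{D}[f]]=\langle a,c\rangle\mathsf{D}[f]$; (7) $\langle\langle a,b\rangle,\langle c,d\rangle\rangle\mathsf{D}[\mathsf{D}[f]]=\langle\langle a,c\rangle,\langle b,d\rangle\rangle\mathsf{D}[\mathsf{D}[f]]$. A \emph{Cartesian differential category} is a Cartesian left additive category with a differential combinator. A \emph{reverse differential combinator} on $\mathbb{X}$ sends each $f:A\to B$ to a map $\mathsf{R}[f]:A\times B\to A$ such that (1) $\mathsf{R}[f+g]=\mathsf{R}[f]+\mathsf{R}[g]$, $\mathsf{R}[0]=0$; (2) $\langle a,b+c\rangle\mathsf{R}[f]=\langle a,b\rangle\mathsf{R}[f]+\langle a,c\rangle\mathsf{R}[f]$, $\langle a,0\rangle\mathsf{R}[f]=0$; (3) $\mathsf{R}[1]=\pi_1$, $\mathsf{R}[\pi_0]=\pi_1\iota_0$, $\mathsf{R}[\pi_1]=\pi_1\iota_1$; (4) $\mathsf{R}[\langle f,g\rangle]=(1\times\pi_0)\mathsf{R}[f]+(1\times\pi_1)\mathsf{R}[g]$, and $\mathsf{R}[!_A]=0$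 for the map $!_A$ to the terminal object; (5) $\mathsf{R}[fg]=\langle\pi_0,\langle\pi_0f,\pi_1\rangle\rangle(1\times\mathsf{R}[g])\mathsf{R}[f]$; (6) $\langle 1\times\pi_0,0\times\pi_1\rangle(\iota_0\times 1)\mathsf{R}[\mathsf{R}[\mathsf{R}[f]]]\pi_1=(1\times\pi_1)\mathsf{R}[f]$; (7) $k=\mathsf{ex}\,k$ for $k=(\iota_0\times 1)\mathsf{R}[\mathsf{R}[(\iota_0\times 1)\mathsf{R}[\mathsf{R}[f]]\pi_1]]\pi_1$. A \emph{Cartesian reverse differential category} is a Cartesian left additive category with a reverse differential combinator. Let $\mathsf{D}$ be a differential combinator. A map $f:A\times B\to C$ is \emph{linear in $B$} if $\langle 1\times\pi_0,0\times\pi_1\rangle\mathsf{D}[f]=(1\times\pi_1)f$. The \emph{simple linear fibration} $\widetilde{\mathsf{Lin}(\mathbb{X})}\to\mathbb{X}$, $(I,A)\mapsto I$, has as total category the pairs $(I,A)$ of objects, with maps $(f,g):(I,A)\to(J,B)$ given by $f:I\to J$ and $g:I\times A\to B$ linear in $A$, with identity $(1,\pi_1)$ and composition $(f,g)(f',g')=(ff',\langle\pi_0f,g\rangle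 g')$; its cloven Cartesian arrows are the $(f,\pi_1)$. Its fibre over $I$ is $\mathsf{Lin}(\mathbb{X})[I]$, in which the product $A\times B$ of $\mathbb{X}$ is a biproduct with projections $\pi_1\pi_0,\pi_1\pi_1$ and injections $\pi_1\iota_0,\pi_1\iota_1$. The \emph{dual} fibration $\widetilde{\mathsf{Lin}(\mathbb{X})}^*\to\mathbb{X}$ has the same objects, its maps $(f,g):(I,A)\to(J,B)$ are given by $f:I\to J$ and $g:I\times B\to A$ linear in $B$, with composition $(f,g)(f',g')=(ff',\langle\pi_0,\langle\pi_0f,\pi_1\rangle\rangle(1\times g')g)$; its cloven Cartesian arrows are again the $(f,\pi_1)$. A \emph{contextual linear dagger} on $(\mathbb{X},\mathsf{D})$ makes the simple linear fibration a dagger fibration with a dagger cleavage, with $\dagger$-biproducts in its fibres. That is, it is a functor $\dagger:\widetilde{\mathsf{Lin}(\mathbb{X})}\to\widetilde{\mathsf{Lin}(\mathbb{X})}^*$ over $\mathbb{X}$, the identity on objects, which carries Cartesian arrows to Cartesian arrows and the cloven Cartesian arrow $(f,\pi_1)$ to the cloven Cartesian arrow $(f,\pi_1)$, whose composite with the induced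 functor $\widetilde{\mathsf{Lin}(\mathbb{X})}^*\to\widetilde{\mathsf{Lin}(\mathbb{X})}^{**}=\widetilde{\mathsf{Lin}(\mathbb{X})}$ is the identity, and such that, writing $(1,g)^\dagger=(1,g^{\dagger[I]})$ for the induced dagger on the fibre $\mathsf{Lin}(\mathbb{X})[I]$, the biproducts above are $\dagger$-biproducts: $(\pi_1\pi_i)^{\dagger[I]}=\pi_1\iota_i$ for $i=0,1$. \textbf{Theorem.} A Cartesian reverse differential category is precisely a Cartesian differential category with a contextual linear dagger. Explicitly, on every Cartesian left additive category $\mathbb{X}$ there are mutually inverse bijections between reverse differential combinators $\mathsf{R}$ on $\mathbb{X}$ and pairs $(\mathsf{D},\dagger)$ of a differential combinator $\mathsf{D}$ on $\mathbb{X}$ and a contextual linear dagger $\dagger$ on $(\mathbb{X},\mathsf{D})$. In one direction, $\mathsf{R}$ is sent to $\mathsf{D}[f]=(\langle 1,0\rangle\times 1)\,\mathsf{R}[\mathsf{R}[f]]\,\pi_1$ for $f:A\to B$, with the dagger $g^{\dagger[I]}=(\langle 1,0\rangle\times 1)\,\mathsf{R}[g]\,\pi_1$ for $g:I\times A\to B$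 linear in $A$. In the other direction, $(\mathsf{D},\dagger)$ is sent to $\mathsf{R}[f]=\mathsf{D}[f]^{\dagger[A]}$ for $f:A\to B$, where $\mathsf{D}[f]$ is always linear in its second variable. -/

import Mathlib

open CategoryTheory Limits MonoidalCategory CartesianMonoidalCategory

universe v u

namespace RevDiff

section LeftAdditive

/-- A Cartesian left additive category: a category with chosen finite products (Mathlib's
`CartesianMonoidalCategory`), every hom-set of which is a commutative monoid, such that
precomposition preserves the additive structure, and such that the projections are additive.
Composition `f ≫ g` is in diagrammatic order, `X ⊗ Y` is the chosen product, and
`lift f g` is the pairing of `f` and `g`. -/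
class CartesianLeftAdditive (C : Type u) [Category.{v} C] [CartesianMonoidalCategory C] where
  homAddCommMonoid : ∀ X Y : C, AddCommMonoid (X ⟶ Y)
  comp_add : ∀ {X Y Z : C} (x : X ⟶ Y) (f g : Y ⟶ Z), x ≫ (f + g) = x ≫ f + x ≫ g
  comp_zero : ∀ {X Y : C} (x : X ⟶ Y) (Z : C), x ≫ (0 : Y ⟶ Z) = 0
  add_comp_fst : ∀ {X A B : C} (x y : X ⟶ A ⊗ B), (x + y) ≫ fst A B = x ≫ fst A B + y ≫ fst A B
  zero_comp_fst : ∀ X A B : C, (0 : X ⟶ A ⊗ B) ≫ fst A B = 0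
  add_comp_snd : ∀ {X A B : C} (x y : X ⟶ A ⊗ B), (x + y) ≫ snd A B = x ≫ snd A B + y ≫ snd A B
  zero_comp_snd : ∀ X A B : C, (0 : X ⟶ A ⊗ B) ≫ snd A B = 0

attribute [reducible, instance] CartesianLeftAdditive.homAddCommMonoid

variable {C : Type u} [Category.{v} C] [CartesianMonoidalCategory C] [CartesianLeftAdditive C]

/-- The injection `ι₀ = ⟨1, 0⟩ : A ⟶ A × B`. -/
def ι₀ (A B : C) : A ⟶ A ⊗ B := lift (𝟙 A) 0

/-- The injection `ι₁ = ⟨0, 1⟩ : B ⟶ A × B`. -/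
def ι₁ (A B : C) : B ⟶ A ⊗ B := lift 0 (𝟙 B)

/-- The exchange isomorphism `ex = ⟨π₀ × π₀, π₁ × π₁⟩`. -/
def ex (A B A' B' : C) : (A ⊗ B) ⊗ (A' ⊗ B') ⟶ (A ⊗ A') ⊗ (B ⊗ B') :=
  lift (fst A B ⊗ₘ fst A' B') (snd A B ⊗ₘ snd A' B')

end LeftAdditive

section Combinators

/-- A differential combinator on a Cartesian left additive category. A Cartesian differential
category is a Cartesian left additive category together with such a combinator. The point is the
first variable of `D f`, the vector the second. -/
@[ext]
structure DiffCombinator (C : Type u) [Category.{v} C] [CartesianMonoidalCategory C]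
    [CartesianLeftAdditive C] where
  D : ∀ {A B : C}, (A ⟶ B) → (A ⊗ A ⟶ B)
  D_add : ∀ {A B : C} (f g : A ⟶ B), D (f + g) = D f + D g
  D_zero : ∀ A B : C, D (0 : A ⟶ B) = 0
  add_D : ∀ {X A B : C} (a b c : X ⟶ A) (f : A ⟶ B),
    lift a (b + c) ≫ D f = lift a b ≫ D f + lift a c ≫ D f
  zero_D : ∀ {X A B : C} (a : X ⟶ A) (f : A ⟶ B), lift a 0 ≫ D f = 0
  D_id : ∀ A : C, D (𝟙 A) = snd A A
  D_fst : ∀ A B : C, D (fst A B) = snd (A ⊗ B) (A ⊗ B) ≫ fst A B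
  D_snd : ∀ A B : C, D (snd A B) = snd (A ⊗ B) (A ⊗ B) ≫ snd A B
  D_lift : ∀ {A B B' : C} (f : A ⟶ B) (g : A ⟶ B'), D (lift f g) = lift (D f) (D g)
  D_comp : ∀ {A B B' : C} (f : A ⟶ B) (g : B ⟶ B'),
    D (f ≫ g) = lift (fst A A ≫ f) (D f) ≫ D g
  D_D_linear : ∀ {X A B : C} (a b c : X ⟶ A) (f : A ⟶ B),
    lift (lift a b) (lift 0 c) ≫ D (D f) = lift a c ≫ D f
  D_D_symm : ∀ {X A B : C} (a b c d : X ⟶ A) (f : A ⟶ B),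
    lift (lift a b) (lift c d) ≫ D (D f) = lift (lift a c) (lift b d) ≫ D (D f)

/-- A reverse differential combinator on a Cartesian left additive category. A Cartesian reverse
differential category is a Cartesian left additive category together with such a combinator. -/
@[ext]
structure ReverseDiffCombinator (C : Type u) [Category.{v} C] [CartesianMonoidalCategory C]
    [CartesianLeftAdditive C] where
  R : ∀ {A B : C}, (A ⟶ B) → (A ⊗ B ⟶ A)
  R_add : ∀ {A B : C} (f g : A ⟶ B), R (f + g) = R f + R g
  R_zero : ∀ A B : C, R (0 : A ⟶ B) = 0
  add_R : ∀ {X A B : C} (a : X ⟶ A) (b c : X ⟶ B) (f : A ⟶ B),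
    lift a (b + c) ≫ R f = lift a b ≫ R f + lift a c ≫ R f
  zero_R : ∀ {X A B : C} (a : X ⟶ A) (f : A ⟶ B), lift a 0 ≫ R f = 0
  R_id : ∀ A : C, R (𝟙 A) = snd A A
  R_fst : ∀ A B : C, R (fst A B) = snd (A ⊗ B) A ≫ ι₀ A B
  R_snd : ∀ A B : C, R (snd A B) = snd (A ⊗ B) B ≫ ι₁ A B
  R_lift : ∀ {A B B' : C} (f : A ⟶ B) (g : A ⟶ B'),
    R (lift f g) = (𝟙 A ⊗ₘ fst B B') ≫ R f + (𝟙 A ⊗ₘ snd B B') ≫ R g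
  R_toUnit : ∀ A : C, R (toUnit A) = 0
  R_comp : ∀ {A B B' : C} (f : A ⟶ B) (g : B ⟶ B'),
    R (f ≫ g) =
      lift (fst A B') (lift (fst A B' ≫ f) (snd A B')) ≫ (𝟙 A ⊗ₘ R g) ≫ R f
  R_linear : ∀ {A B : C} (f : A ⟶ B),
    lift (𝟙 A ⊗ₘ fst B B) ((0 : A ⟶ A) ⊗ₘ snd B B) ≫
        (ι₀ (A ⊗ B) A ⊗ₘ 𝟙 (A ⊗ B)) ≫ R (R (R f)) ≫ snd (A ⊗ B) A =
      (𝟙 A ⊗ₘ snd B B) ≫ R f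
  R_symm : ∀ {A B : C} (f : A ⟶ B),
    (ι₀ (A ⊗ A) B ⊗ₘ 𝟙 (A ⊗ A)) ≫
        R (R ((ι₀ A B ⊗ₘ 𝟙 A) ≫ R (R f) ≫ snd A B)) ≫ snd (A ⊗ A) B =
      ex A A A A ≫ (ι₀ (A ⊗ A) B ⊗ₘ 𝟙 (A ⊗ A)) ≫
        R (R ((ι₀ A B ⊗ₘ 𝟙 A) ≫ R (R f) ≫ snd A B)) ≫ snd (A ⊗ A) B

end Combinators

section LinearMaps

variable {C : Type u} [Category.{v} C] [CartesianMonoidalCategory C] [CartesianLeftAdditive C]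

/-- The partial derivative `D_B[f] = ⟨1 × π₀, 0 × π₁⟩ D[f]` of `f : A × B ⟶ B'`. -/
def DiffCombinator.partialD (𝒟 : DiffCombinator C) {A B B' : C} (f : A ⊗ B ⟶ B') :
    A ⊗ (B ⊗ B) ⟶ B' :=
  lift (𝟙 A ⊗ₘ fst B B) ((0 : A ⟶ A) ⊗ₘ snd B B) ≫ 𝒟.D f

/-- A map `f : A × B ⟶ B'` is linear in `B` when `D_B[f] = (1 × π₁) f`. -/
def DiffCombinator.IsLinearIn (𝒟 : DiffCombinator C) {A B B' : C} (f : A ⊗ B ⟶ B') : Prop :=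
  𝒟.partialD f = (𝟙 A ⊗ₘ snd B B) ≫ f

lemma lift_ι₀ {X A B : C} (a : X ⟶ A) : a ≫ ι₀ A B = lift a 0 := by
  simp [ι₀, comp_lift, CartesianLeftAdditive.comp_zero]

lemma lift_ι₁ {X A B : C} (b : X ⟶ B) : b ≫ ι₁ A B = lift 0 b := by
  simp [ι₁, comp_lift, CartesianLeftAdditive.comp_zero]

lemma lift_add {X A B : C} (a a' : X ⟶ A) (b b' : X ⟶ B) :
    lift (a + a') (b + b') = lift a b + lift a' b' := by
  apply CartesianMonoidalCategory.hom_ext <;>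
    simp [CartesianLeftAdditive.add_comp_fst, CartesianLeftAdditive.add_comp_snd]

lemma lift_zero (X A B : C) : lift (0 : X ⟶ A) (0 : X ⟶ B) = 0 := by
  apply CartesianMonoidalCategory.hom_ext <;>
    simp [CartesianLeftAdditive.zero_comp_fst, CartesianLeftAdditive.zero_comp_snd]

variable {𝒟 : DiffCombinator C}

lemma DiffCombinator.isLinearIn_iff {A B B' : C} (f : A ⊗ B ⟶ B') :
    𝒟.IsLinearIn f ↔ ∀ {X : C} (a : X ⟶ A) (b c : X ⟶ B),
      lift (lift a b) (lift 0 c) ≫ 𝒟.D f = lift a c ≫ f := by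
  have key : ∀ {X : C} (a : X ⟶ A) (b c : X ⟶ B),
      lift (lift a b) (lift 0 c) =
        lift a (lift b c) ≫ lift (𝟙 A ⊗ₘ fst B B) ((0 : A ⟶ A) ⊗ₘ snd B B) := by
    intro X a b c
    simp [comp_lift, lift_map, CartesianLeftAdditive.comp_zero]
  constructor
  · intro h X a b c
    rw [key, Category.assoc]
    have h' : lift (𝟙 A ⊗ₘ fst B B) ((0 : A ⟶ A) ⊗ₘ snd B B) ≫ 𝒟.D f =
      (𝟙 A ⊗ₘ snd B B) ≫ f := h
    rw [h', lift_map_assoc]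
    simp
  · intro h
    have h1 := h (fst A (B ⊗ B)) (snd A (B ⊗ B) ≫ fst B B) (snd A (B ⊗ B) ≫ snd B B)
    have h2 : lift (fst A (B ⊗ B)) (lift (snd A (B ⊗ B) ≫ fst B B) (snd A (B ⊗ B) ≫ snd B B)) =
        𝟙 _ := by
      apply CartesianMonoidalCategory.hom_ext
      · simp
      · apply CartesianMonoidalCategory.hom_ext <;> simp
    rw [key, h2, Category.id_comp] at h1
    have h3 : (𝟙 A ⊗ₘ snd B B) = lift (fst A (B ⊗ B)) (snd A (B ⊗ B) ≫ snd B B) := by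
      apply CartesianMonoidalCategory.hom_ext <;> simp
    change _ ≫ 𝒟.D f = _
    rw [h1, h3]

lemma DiffCombinator.isLinearIn_snd (A B : C) : 𝒟.IsLinearIn (snd A B) := by
  rw [isLinearIn_iff]
  intro X a b c
  simp [𝒟.D_snd]

lemma DiffCombinator.isLinearIn_zero (A B B' : C) : 𝒟.IsLinearIn (0 : A ⊗ B ⟶ B') := by
  rw [isLinearIn_iff]
  intro X a b c
  simp [𝒟.D_zero, CartesianLeftAdditive.comp_zero]

lemma DiffCombinator.IsLinearIn.add {A B B' : C} {f g : A ⊗ B ⟶ B'}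
    (hf : 𝒟.IsLinearIn f) (hg : 𝒟.IsLinearIn g) : 𝒟.IsLinearIn (f + g) := by
  rw [isLinearIn_iff] at *
  intro X a b c
  rw [𝒟.D_add, CartesianLeftAdditive.comp_add, hf, hg, CartesianLeftAdditive.comp_add]

lemma DiffCombinator.IsLinearIn.lift {A B B' B'' : C} {f : A ⊗ B ⟶ B'} {g : A ⊗ B ⟶ B''}
    (hf : 𝒟.IsLinearIn f) (hg : 𝒟.IsLinearIn g) :
    𝒟.IsLinearIn (CartesianMonoidalCategory.lift f g) := by
  rw [isLinearIn_iff] at *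
  intro X a b c
  rw [𝒟.D_lift, comp_lift, hf, hg, comp_lift]

lemma DiffCombinator.IsLinearIn.comp {A A' B B' B'' : C} {g : A ⊗ B ⟶ B'} {g' : A' ⊗ B' ⟶ B''}
    (f : A ⟶ A') (hg : 𝒟.IsLinearIn g) (hg' : 𝒟.IsLinearIn g') :
    𝒟.IsLinearIn (CartesianMonoidalCategory.lift (fst A B ≫ f) g ≫ g') := by
  rw [isLinearIn_iff] at *
  intro X a b c
  simp [𝒟.D_comp, 𝒟.D_lift, 𝒟.D_fst, ← Category.assoc, comp_lift, 𝒟.zero_D, hg, hg']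

lemma DiffCombinator.IsLinearIn.dualComp {A A' B B' B'' : C} {g : A ⊗ B' ⟶ B}
    {g' : A' ⊗ B'' ⟶ B'} (f : A ⟶ A') (hg : 𝒟.IsLinearIn g) (hg' : 𝒟.IsLinearIn g') :
    𝒟.IsLinearIn (CartesianMonoidalCategory.lift (fst A B'')
      (CartesianMonoidalCategory.lift (fst A B'' ≫ f) (snd A B'')) ≫ (𝟙 A ⊗ₘ g') ≫ g) := by
  have h : 𝒟.IsLinearIn (CartesianMonoidalCategory.lift (fst A B'' ≫ f) (snd A B'') ≫ g') :=
    DiffCombinator.IsLinearIn.comp f (isLinearIn_snd A B'') hg'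
  have h' := DiffCombinator.IsLinearIn.comp (𝟙 A) h hg
  simpa [lift_map_assoc] using h'

lemma DiffCombinator.IsLinearIn.map_add {X A B B' : C} {f : A ⊗ B ⟶ B'} (hf : 𝒟.IsLinearIn f)
    (a : X ⟶ A) (b c : X ⟶ B) :
    CartesianMonoidalCategory.lift a (b + c) ≫ f =
      CartesianMonoidalCategory.lift a b ≫ f + CartesianMonoidalCategory.lift a c ≫ f := by
  rw [isLinearIn_iff] at hf
  rw [← hf a 0 (b + c), ← hf a 0 b, ← hf a 0 c, ← 𝒟.add_D, ← lift_add]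
  simp

lemma DiffCombinator.IsLinearIn.map_zero {X A B B' : C} {f : A ⊗ B ⟶ B'} (hf : 𝒟.IsLinearIn f)
    (a : X ⟶ A) : CartesianMonoidalCategory.lift a 0 ≫ f = 0 := by
  rw [isLinearIn_iff] at hf
  rw [← hf a 0 0, lift_zero, 𝒟.zero_D]

lemma DiffCombinator.IsLinearIn.eq_sum {I A B E : C} {m : I ⊗ (A ⊗ B) ⟶ E}
    (hm : 𝒟.IsLinearIn m) :
    m = CartesianMonoidalCategory.lift (fst I (A ⊗ B)) (snd I (A ⊗ B) ≫ fst A B) ≫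
        (CartesianMonoidalCategory.lift (fst I A) (snd I A ≫ ι₀ A B) ≫ m) +
      CartesianMonoidalCategory.lift (fst I (A ⊗ B)) (snd I (A ⊗ B) ≫ snd A B) ≫
        (CartesianMonoidalCategory.lift (fst I B) (snd I B ≫ ι₁ A B) ≫ m) := by
  have h := hm.map_add (fst I (A ⊗ B))
    (CartesianMonoidalCategory.lift (snd I (A ⊗ B) ≫ fst A B) 0)
    (CartesianMonoidalCategory.lift 0 (snd I (A ⊗ B) ≫ snd A B))
  simp only [← lift_add, add_zero, zero_add, lift_comp_fst_snd, lift_fst_snd,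
    Category.id_comp] at h
  refine h.trans ?_
  simp [← Category.assoc, comp_lift, lift_ι₀, lift_ι₁, CartesianLeftAdditive.comp_zero]

end LinearMaps

section LinearFibration

variable {C : Type u} [Category.{v} C] [CartesianMonoidalCategory C] [CartesianLeftAdditive C]

/-- Objects `(I, A)` of the total category of the simple linear fibration. -/
structure LinTotal (𝒟 : DiffCombinator C) where
  base : C
  fib : C

/-- A map `(I, A) ⟶ (J, B)`: a pair of `base : I ⟶ J` and `fib : I × A ⟶ B`, linear in `A`. -/
@[ext]
structure LinTotal.Hom {𝒟 : DiffCombinator C} (X Y : LinTotal 𝒟) where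
  base : X.base ⟶ Y.base
  fib : X.base ⊗ X.fib ⟶ Y.fib
  linear : 𝒟.IsLinearIn fib

/-- The total category of the simple linear fibration. -/
instance (𝒟 : DiffCombinator C) : Category (LinTotal 𝒟) where
  Hom X Y := LinTotal.Hom X Y
  id X := ⟨𝟙 X.base, snd X.base X.fib, DiffCombinator.isLinearIn_snd _ _⟩
  comp φ ψ := ⟨φ.base ≫ ψ.base, lift (fst _ _ ≫ φ.base) φ.fib ≫ ψ.fib,
    DiffCombinator.IsLinearIn.comp φ.base φ.linear ψ.linear⟩
  id_comp φ := by apply LinTotal.Hom.ext <;> simp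
  comp_id φ := by apply LinTotal.Hom.ext <;> simp
  assoc φ ψ χ := by
    apply LinTotal.Hom.ext
    · simp
    · simp [← Category.assoc, comp_lift]

/-- The simple linear fibration `(I, A) ↦ I`. -/
def linProj (𝒟 : DiffCombinator C) : LinTotal 𝒟 ⥤ C where
  obj X := X.base
  map φ := φ.base

/-- The cloven Cartesian arrow `(f, π₁) : (I, A) ⟶ (J, A)` of the simple linear fibration. -/
def LinTotal.cart (𝒟 : DiffCombinator C) {I J : C} (f : I ⟶ J) (A : C) :
    (⟨I, A⟩ : LinTotal 𝒟) ⟶ ⟨J, A⟩ :=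
  (⟨f, snd I A, DiffCombinator.isLinearIn_snd I A⟩ : LinTotal.Hom _ _)

/-- The vertical arrow `(1, g) : (I, A) ⟶ (I, B)` given by `g : I × A ⟶ B` linear in `A`. -/
def LinTotal.vert {𝒟 : DiffCombinator C} {I A B : C} (g : I ⊗ A ⟶ B) (hg : 𝒟.IsLinearIn g) :
    (⟨I, A⟩ : LinTotal 𝒟) ⟶ ⟨I, B⟩ :=
  (⟨𝟙 I, g, hg⟩ : LinTotal.Hom _ _)

/-- Objects `(I, A)` of the total category of the dual of the simple linear fibration. -/
structure LinDual (𝒟 : DiffCombinator C) where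
  base : C
  fib : C

/-- A map `(I, A) ⟶ (J, B)` in the dual fibration: a pair of `base : I ⟶ J` and
`fib : I × B ⟶ A`, linear in `B`. It stands for the class of the span consisting of the vertical
arrow `(1, fib) : (I, B) ⟶ (I, A)` and the Cartesian arrow `(base, π₁) : (I, B) ⟶ (J, B)` of the
simple linear fibration; every class of such spans has exactly one representative of this form
(`LinDual.existsUnique_toSpan`), and composition is that of spans (`LinDual.toSpan_comp`). -/
@[ext]
structure LinDual.Hom {𝒟 : DiffCombinator C} (X Y : LinDual 𝒟) where
  base : X.base ⟶ Y.base
  fib : X.base ⊗ Y.fib ⟶ X.fib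
  linear : 𝒟.IsLinearIn fib

/-- The total category of the dual of the simple linear fibration; the composite of `(f, g)` and
`(f', g')` is `(f f', ⟨π₀, ⟨π₀ f, π₁⟩⟩ (1 × g') g)`. -/
instance (𝒟 : DiffCombinator C) : Category (LinDual 𝒟) where
  Hom X Y := LinDual.Hom X Y
  id X := ⟨𝟙 X.base, snd X.base X.fib, DiffCombinator.isLinearIn_snd _ _⟩
  comp φ ψ := ⟨φ.base ≫ ψ.base,
    lift (fst _ _) (lift (fst _ _ ≫ φ.base) (snd _ _)) ≫ (𝟙 _ ⊗ₘ ψ.fib) ≫ φ.fib,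
    DiffCombinator.IsLinearIn.dualComp φ.base φ.linear ψ.linear⟩
  id_comp φ := by apply LinDual.Hom.ext <;> simp
  comp_id φ := by apply LinDual.Hom.ext <;> simp
  assoc φ ψ χ := by
    apply LinDual.Hom.ext
    · simp
    · simp [← Category.assoc, comp_lift]

/-- The dual of the simple linear fibration, `(I, A) ↦ I`. -/
def dualProj (𝒟 : DiffCombinator C) : LinDual 𝒟 ⥤ C where
  obj X := X.base
  map φ := φ.base

/-- The cloven Cartesian arrow `(f, π₁) : (I, A) ⟶ (J, A)` of the dual fibration. -/
def LinDual.cart (𝒟 : DiffCombinator C) {I J : C} (f : I ⟶ J) (A : C) :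
    (⟨I, A⟩ : LinDual 𝒟) ⟶ ⟨J, A⟩ :=
  (⟨f, snd I A, DiffCombinator.isLinearIn_snd I A⟩ : LinDual.Hom _ _)

lemma linProj_isHomLift_iff {𝒟 : DiffCombinator C} {X Y : LinTotal 𝒟} (f : X.base ⟶ Y.base)
    (φ : X ⟶ Y) : (linProj 𝒟).IsHomLift f φ ↔ f = φ.base := by
  constructor
  · intro h
    exact @IsHomLift.eq_of_isHomLift _ _ _ _ (linProj 𝒟) X Y f φ h
  · rintro rfl
    exact inferInstanceAs ((linProj 𝒟).IsHomLift ((linProj 𝒟).map φ) φ)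

lemma dualProj_isHomLift_iff {𝒟 : DiffCombinator C} {X Y : LinDual 𝒟} (f : X.base ⟶ Y.base)
    (φ : X ⟶ Y) : (dualProj 𝒟).IsHomLift f φ ↔ f = φ.base := by
  constructor
  · intro h
    exact @IsHomLift.eq_of_isHomLift _ _ _ _ (dualProj 𝒟) X Y f φ h
  · rintro rfl
    exact inferInstanceAs ((dualProj 𝒟).IsHomLift ((dualProj 𝒟).map φ) φ)

theorem LinTotal.cart_isStronglyCartesian (𝒟 : DiffCombinator C) {I J : C} (f : I ⟶ J) (A : C) :
    (linProj 𝒟).IsStronglyCartesian f (LinTotal.cart 𝒟 f A) where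
  toIsHomLift := (linProj_isHomLift_iff (X := ⟨I, A⟩) (Y := ⟨J, A⟩) f _).2 rfl
  universal_property' {X} g φ h := by
    change X.base ⟶ I at g
    have hb : g ≫ f = φ.base := (linProj_isHomLift_iff (Y := ⟨J, A⟩) (g ≫ f) φ).1 h
    refine ⟨(⟨g, φ.fib, φ.linear⟩ : LinTotal.Hom X (⟨I, A⟩ : LinTotal 𝒟)), ⟨?_, ?_⟩, ?_⟩
    · exact (linProj_isHomLift_iff (Y := ⟨I, A⟩) g _).2 rfl
    · apply LinTotal.Hom.ext
      · exact hb
      · exact lift_snd _ _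
    · rintro χ ⟨h1, h2⟩
      apply LinTotal.Hom.ext
      · exact ((linProj_isHomLift_iff (Y := ⟨I, A⟩) g χ).1 h1).symm
      · have h3 : lift (fst _ _ ≫ χ.base) χ.fib ≫ snd I A = φ.fib :=
          congrArg LinTotal.Hom.fib h2
        rw [lift_snd] at h3
        exact h3

theorem LinDual.cart_isStronglyCartesian (𝒟 : DiffCombinator C) {I J : C} (f : I ⟶ J) (A : C) :
    (dualProj 𝒟).IsStronglyCartesian f (LinDual.cart 𝒟 f A) where
  toIsHomLift := (dualProj_isHomLift_iff (X := ⟨I, A⟩) (Y := ⟨J, A⟩) f _).2 rfl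
  universal_property' {X} g φ h := by
    change X.base ⟶ I at g
    have hb : g ≫ f = φ.base := (dualProj_isHomLift_iff (Y := ⟨J, A⟩) (g ≫ f) φ).1 h
    have key : ∀ χ : LinDual.Hom X (⟨I, A⟩ : LinDual 𝒟),
        lift (fst X.base A) (lift (fst X.base A ≫ χ.base) (snd X.base A)) ≫
          (𝟙 X.base ⊗ₘ snd I A) ≫ χ.fib = χ.fib := by
      intro χ
      rw [lift_map_assoc]
      simp
    refine ⟨(⟨g, φ.fib, φ.linear⟩ : LinDual.Hom X (⟨I, A⟩ : LinDual 𝒟)), ⟨?_, ?_⟩, ?_⟩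
    · exact (dualProj_isHomLift_iff (Y := ⟨I, A⟩) g _).2 rfl
    · apply LinDual.Hom.ext
      · exact hb
      · exact key ⟨g, φ.fib, φ.linear⟩
    · rintro χ ⟨h1, h2⟩
      apply LinDual.Hom.ext
      · exact ((dualProj_isHomLift_iff (Y := ⟨I, A⟩) g χ).1 h1).symm
      · exact (key χ).symm.trans (congrArg LinDual.Hom.fib h2)

instance (𝒟 : DiffCombinator C) : (linProj 𝒟).IsFibered :=
  Functor.IsFibered.of_exists_isStronglyCartesian fun a R f =>
    ⟨⟨R, a.fib⟩, LinTotal.cart 𝒟 f a.fib, LinTotal.cart_isStronglyCartesian 𝒟 f a.fib⟩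

instance (𝒟 : DiffCombinator C) : (dualProj 𝒟).IsFibered :=
  Functor.IsFibered.of_exists_isStronglyCartesian fun a R f =>
    ⟨⟨R, a.fib⟩, LinDual.cart 𝒟 f a.fib, LinDual.cart_isStronglyCartesian 𝒟 f a.fib⟩

end LinearFibration

section DualSpans

/-- A span `X ⟵ apex ⟶ Y` of a vertical arrow and a Cartesian arrow, for a functor `q`. -/
structure DualSpan {K : Type*} {B : Type*} [Category K] [Category B] (q : K ⥤ B) (X Y : K) where
  apex : K
  vert : apex ⟶ X
  cart : apex ⟶ Y
  base : q.obj X ⟶ q.obj Y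
  isVertical : q.IsHomLift (𝟙 (q.obj X)) vert
  isCartesian : q.IsStronglyCartesian base cart

/-- The equivalence of spans under which the classes are the maps `X ⟶ Y` of the dual fibration:
there is a vertical isomorphism between the apices that is compatible with the legs. -/
def DualSpan.Equivalent {K : Type*} {B : Type*} [Category K] [Category B] {q : K ⥤ B} {X Y : K}
    (s t : DualSpan q X Y) : Prop :=
  ∃ α : s.apex ≅ t.apex, q.IsHomLift (𝟙 (q.obj X)) α.hom ∧
    α.hom ≫ t.vert = s.vert ∧ α.hom ≫ t.cart = s.cart

variable {C : Type u} [Category.{v} C] [CartesianMonoidalCategory C] [CartesianLeftAdditive C]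
  {𝒟 : DiffCombinator C}

/-- The span of the simple linear fibration that a map of `LinDual` stands for. -/
def LinDual.toSpan {X Y : LinTotal 𝒟}
    (φ : (⟨X.base, X.fib⟩ : LinDual 𝒟) ⟶ ⟨Y.base, Y.fib⟩) : DualSpan (linProj 𝒟) X Y where
  apex := ⟨X.base, Y.fib⟩
  vert := LinTotal.vert φ.fib φ.linear
  cart := LinTotal.cart 𝒟 φ.base Y.fib
  base := φ.base
  isVertical := (linProj_isHomLift_iff (X := ⟨X.base, Y.fib⟩) (Y := X) (𝟙 X.base) _).2 rfl
  isCartesian := LinTotal.cart_isStronglyCartesian 𝒟 φ.base Y.fib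

/-- Every class of spans has exactly one representative that comes from a map of `LinDual`. -/
theorem LinDual.existsUnique_toSpan {X Y : LinTotal 𝒟} (s : DualSpan (linProj 𝒟) X Y) :
    ∃! φ : (⟨X.base, X.fib⟩ : LinDual 𝒟) ⟶ ⟨Y.base, Y.fib⟩,
      s.Equivalent (LinDual.toSpan φ) := by
  obtain ⟨⟨T, E⟩, vt, ct, f, hv, hc⟩ := s
  obtain ⟨I, A⟩ := X
  have hT : T = I := @IsHomLift.domain_eq _ _ _ _ (linProj 𝒟) _ _ _ _ _ _ hv
  subst hT
  change T ⟶ Y.base at f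
  have hc1 : (linProj 𝒟).IsStronglyCartesian f ct := hc
  have hc2 : (linProj 𝒟).IsCartesian f ct := inferInstance
  have hcart := LinTotal.cart_isStronglyCartesian 𝒟 f Y.fib
  have hcart' : (linProj 𝒟).IsCartesian f (LinTotal.cart 𝒟 f Y.fib) := inferInstance
  have hlift : (linProj 𝒟).IsHomLift f ct := hc1.toIsHomLift
  obtain ⟨α, hα2, hα1⟩ : ∃ α : (⟨T, E⟩ : LinTotal 𝒟) ≅ ⟨T, Y.fib⟩,
      (linProj 𝒟).IsHomLift (𝟙 T) α.hom ∧ α.hom ≫ LinTotal.cart 𝒟 f Y.fib = ct :=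
    ⟨Functor.IsCartesian.domainUniqueUpToIso (linProj 𝒟) f (LinTotal.cart 𝒟 f Y.fib) ct,
      by rw [Functor.IsCartesian.domainUniqueUpToIso_hom]; infer_instance,
      by rw [Functor.IsCartesian.domainUniqueUpToIso_hom, Functor.IsCartesian.fac]⟩
  have hvb : 𝟙 T = vt.base := (linProj_isHomLift_iff (X := ⟨T, E⟩) (Y := ⟨T, A⟩) (𝟙 T) vt).1 hv
  have hαb : 𝟙 T = α.hom.base :=
    (linProj_isHomLift_iff (X := ⟨T, E⟩) (Y := ⟨T, Y.fib⟩) (𝟙 T) α.hom).1 hα2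
  have hib : 𝟙 T = (α.inv ≫ vt).base := by
    have h1 : (α.inv ≫ vt).base = α.inv.base ≫ vt.base := rfl
    have h2 : α.inv.base ≫ α.hom.base = 𝟙 T := congrArg LinTotal.Hom.base α.inv_hom_id
    rw [← hαb, Category.comp_id] at h2
    rw [h1, ← hvb, h2, Category.comp_id]
  let φ₀ : (⟨T, A⟩ : LinDual 𝒟) ⟶ ⟨Y.base, Y.fib⟩ :=
    (⟨f, (α.inv ≫ vt).fib, (α.inv ≫ vt).linear⟩ : LinDual.Hom _ _)
  refine ⟨φ₀, ⟨α, hα2, ?_, hα1⟩, ?_⟩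
  · have : LinTotal.vert (α.inv ≫ vt).fib (α.inv ≫ vt).linear = α.inv ≫ vt :=
      LinTotal.Hom.ext hib rfl
    change α.hom ≫ LinTotal.vert (α.inv ≫ vt).fib (α.inv ≫ vt).linear = vt
    rw [this, Iso.hom_inv_id_assoc]
  · rintro φ ⟨β, hβ, h1, h2⟩
    change ((⟨T, E⟩ : LinTotal 𝒟) ≅ ⟨T, Y.fib⟩) at β
    have hβ' : (linProj 𝒟).IsHomLift (𝟙 T) β.hom := hβ
    change β.hom ≫ LinTotal.vert φ.fib φ.linear = vt at h1
    change β.hom ≫ LinTotal.cart 𝒟 φ.base Y.fib = ct at h2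
    have hβb : 𝟙 T = β.hom.base :=
      (linProj_isHomLift_iff (X := ⟨T, E⟩) (Y := ⟨T, Y.fib⟩) (𝟙 T) β.hom).1 hβ
    have hct : f = ct.base :=
      (linProj_isHomLift_iff (X := ⟨T, E⟩) (Y := Y) f ct).1 hc.toIsHomLift
    have hφf : φ.base = f := by
      have h3 : β.hom.base ≫ φ.base = ct.base := congrArg LinTotal.Hom.base h2
      rw [← hβb, Category.id_comp] at h3
      rw [h3, hct]
    have hβα : β.hom = α.hom := by
      rw [hφf] at h2
      exact Functor.IsCartesian.ext (linProj 𝒟) f (LinTotal.cart 𝒟 f Y.fib) _ _ (h2.trans hα1.symm)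
    have hv' : α.inv ≫ vt = LinTotal.vert φ.fib φ.linear := by
      rw [← h1, hβα, Iso.inv_hom_id_assoc]
    apply LinDual.Hom.ext
    · exact hφf
    · exact (congrArg LinTotal.Hom.fib hv').symm

/-- The composition of `LinDual` is that of spans: for `(f, g)` followed by `(f', g')`, completing
the cospan of the Cartesian leg of the first and the vertical leg of the second by the arrows below
(a vertical one and a Cartesian one) yields the span of the composite. -/
theorem LinDual.toSpan_comp {X Y Z : LinTotal 𝒟}
    (φ : (⟨X.base, X.fib⟩ : LinDual 𝒟) ⟶ ⟨Y.base, Y.fib⟩)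
    (ψ : (⟨Y.base, Y.fib⟩ : LinDual 𝒟) ⟶ ⟨Z.base, Z.fib⟩) :
    ∃ w : (⟨X.base, Z.fib⟩ : LinTotal 𝒟) ⟶ ⟨X.base, Y.fib⟩,
      (linProj 𝒟).IsHomLift (𝟙 X.base) w ∧
      w ≫ LinTotal.cart 𝒟 φ.base Y.fib =
        LinTotal.cart 𝒟 φ.base Z.fib ≫ LinTotal.vert ψ.fib ψ.linear ∧
      (LinDual.toSpan (φ ≫ ψ)).vert = w ≫ (LinDual.toSpan φ).vert ∧
      (LinDual.toSpan (φ ≫ ψ)).cart =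
        LinTotal.cart 𝒟 φ.base Z.fib ≫ (LinDual.toSpan ψ).cart := by
  have hw : 𝒟.IsLinearIn (lift (fst X.base Z.fib ≫ φ.base) (snd X.base Z.fib) ≫ ψ.fib) :=
    DiffCombinator.IsLinearIn.comp φ.base (DiffCombinator.isLinearIn_snd _ _) ψ.linear
  refine ⟨LinTotal.vert _ hw,
    (linProj_isHomLift_iff (X := ⟨X.base, Z.fib⟩) (Y := ⟨X.base, Y.fib⟩) _ _).2 rfl, ?_, ?_, ?_⟩
  · apply LinTotal.Hom.ext
    · exact (Category.id_comp φ.base).trans (Category.comp_id φ.base).symm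
    · exact lift_snd _ _
  · apply LinTotal.Hom.ext
    · exact (Category.id_comp (𝟙 X.base)).symm
    · change lift (fst X.base Z.fib) (lift (fst X.base Z.fib ≫ φ.base) (snd X.base Z.fib)) ≫
          (𝟙 X.base ⊗ₘ ψ.fib) ≫ φ.fib =
        lift (fst X.base Z.fib ≫ 𝟙 X.base)
          (lift (fst X.base Z.fib ≫ φ.base) (snd X.base Z.fib) ≫ ψ.fib) ≫ φ.fib
      rw [lift_map_assoc]
  · apply LinTotal.Hom.ext
    · rfl
    · exact (lift_snd _ _).symm

end DualSpans

section Fibre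

variable {C : Type u} [Category.{v} C] [CartesianMonoidalCategory C] [CartesianLeftAdditive C]

/-- Objects of the fibre `Lin(C)[I]` of the simple linear fibration. -/
structure LinFibre (𝒟 : DiffCombinator C) (I : C) where
  obj : C

/-- The fibre `Lin(C)[I]`: a map `A ⟶ B` is a map `g : I × A ⟶ B` of `C` that is linear in `A`. -/
instance (𝒟 : DiffCombinator C) (I : C) : Category (LinFibre 𝒟 I) where
  Hom A B := {g : I ⊗ A.obj ⟶ B.obj // 𝒟.IsLinearIn g}
  id A := ⟨snd I A.obj, DiffCombinator.isLinearIn_snd _ _⟩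
  comp g h := ⟨lift (fst _ _) g.1 ≫ h.1, by
    simpa using DiffCombinator.IsLinearIn.comp (𝟙 I) g.2 h.2⟩
  id_comp g := by apply Subtype.ext; simp
  comp_id g := by apply Subtype.ext; simp
  assoc g h k := by apply Subtype.ext; simp [← Category.assoc, comp_lift]

variable {𝒟 : DiffCombinator C} {I : C}

/-- The map of the fibre over `I` given by a map of `C` that is linear in its second variable. -/
def LinFibre.ofLinear {A B : C} (g : I ⊗ A ⟶ B) (hg : 𝒟.IsLinearIn g) :
    (⟨A⟩ : LinFibre 𝒟 I) ⟶ ⟨B⟩ := ⟨g, hg⟩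

lemma LinFibre.comp_val {A B E : LinFibre 𝒟 I} (g : A ⟶ B) (h : B ⟶ E) :
    (g ≫ h).1 = lift (fst _ _) g.1 ≫ h.1 := rfl

lemma LinFibre.id_val (A : LinFibre 𝒟 I) : (𝟙 A : A ⟶ A).1 = snd I A.obj := rfl

instance : HasZeroMorphisms (LinFibre 𝒟 I) where
  zero _ _ := ⟨⟨0, DiffCombinator.isLinearIn_zero _ _ _⟩⟩
  comp_zero _ _ := Subtype.ext (CartesianLeftAdditive.comp_zero _ _)
  zero_comp _ _ _ h := Subtype.ext (DiffCombinator.IsLinearIn.map_zero h.2 _)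

lemma LinFibre.zero_val (A B : LinFibre 𝒟 I) : (0 : A ⟶ B).1 = 0 := rfl

/-- The product `A × B` of `C`, with its projections and with the injections `ι₀`, `ι₁`, as a
biproduct in the fibre over `I`. -/
def LinFibre.bicone (A B : LinFibre 𝒟 I) : BinaryBicone A B where
  pt := ⟨A.obj ⊗ B.obj⟩
  fst := ⟨snd _ _ ≫ fst _ _, by
    rw [DiffCombinator.isLinearIn_iff]; intro X a b c
    simp [𝒟.D_comp, 𝒟.D_fst, 𝒟.D_snd]⟩
  snd := ⟨snd _ _ ≫ snd _ _, by
    rw [DiffCombinator.isLinearIn_iff]; intro X a b c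
    simp [𝒟.D_comp, 𝒟.D_snd]⟩
  inl := ⟨snd _ _ ≫ ι₀ _ _, by
    rw [lift_ι₀]
    exact (DiffCombinator.isLinearIn_snd _ _).lift (DiffCombinator.isLinearIn_zero _ _ _)⟩
  inr := ⟨snd _ _ ≫ ι₁ _ _, by
    rw [lift_ι₁]
    exact (DiffCombinator.isLinearIn_zero _ _ _).lift (DiffCombinator.isLinearIn_snd _ _)⟩
  inl_fst := by apply Subtype.ext; simp [LinFibre.comp_val, LinFibre.id_val, lift_ι₀]
  inl_snd := by apply Subtype.ext; simp [LinFibre.comp_val, LinFibre.zero_val, lift_ι₀]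
  inr_fst := by apply Subtype.ext; simp [LinFibre.comp_val, LinFibre.zero_val, lift_ι₁]
  inr_snd := by apply Subtype.ext; simp [LinFibre.comp_val, LinFibre.id_val, lift_ι₁]

/-- `LinFibre.bicone` is a biproduct. -/
def LinFibre.biconeIsBilimit (A B : LinFibre 𝒟 I) : (LinFibre.bicone A B).IsBilimit where
  isLimit := BinaryFan.IsLimit.mk _ (fun f g => ⟨lift f.1 g.1, f.2.lift g.2⟩)
    (fun f g => by apply Subtype.ext; simp [LinFibre.comp_val, LinFibre.bicone])
    (fun f g => by apply Subtype.ext; simp [LinFibre.comp_val, LinFibre.bicone])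
    (fun {T} f g m hf hg => by
      subst hf hg
      apply Subtype.ext
      obtain ⟨m, hm⟩ := m
      change I ⊗ T.obj ⟶ A.obj ⊗ B.obj at m
      change m = lift (lift (fst I T.obj) m ≫ snd I (A.obj ⊗ B.obj) ≫ fst _ _)
        (lift (fst I T.obj) m ≫ snd I (A.obj ⊗ B.obj) ≫ snd _ _)
      simp)
  isColimit := BinaryCofan.IsColimit.mk _
    (fun {T} f g => ⟨lift (fst I (A.obj ⊗ B.obj)) (snd I (A.obj ⊗ B.obj) ≫ fst _ _) ≫ f.1 +
      lift (fst I (A.obj ⊗ B.obj)) (snd I (A.obj ⊗ B.obj) ≫ snd _ _) ≫ g.1, by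
        have h1 := DiffCombinator.IsLinearIn.comp (𝟙 I) (LinFibre.bicone A B).fst.2 f.2
        have h2 := DiffCombinator.IsLinearIn.comp (𝟙 I) (LinFibre.bicone A B).snd.2 g.2
        rw [Category.comp_id] at h1 h2
        exact h1.add h2⟩)
    (fun {T} f g => by
      apply Subtype.ext
      change lift (fst I A.obj) (snd I A.obj ≫ ι₀ A.obj B.obj) ≫ (_ + _) = f.1
      simp [CartesianLeftAdditive.comp_add,
        ← Category.assoc, comp_lift, lift_ι₀, g.2.map_zero])
    (fun {T} f g => by
      apply Subtype.ext
      change lift (fst I B.obj) (snd I B.obj ≫ ι₁ A.obj B.obj) ≫ (_ + _) = g.1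
      simp [CartesianLeftAdditive.comp_add,
        ← Category.assoc, comp_lift, lift_ι₁, f.2.map_zero])
    (fun {T} f g m hf hg => by
      subst hf hg
      apply Subtype.ext
      exact DiffCombinator.IsLinearIn.eq_sum m.2)

/-- The chosen terminal object of `C` is a zero object of the fibre over `I`. -/
lemma LinFibre.isZero_unit : IsZero (⟨𝟙_ C⟩ : LinFibre 𝒟 I) :=
  (IsZero.iff_id_eq_zero _).2 (Subtype.ext (toUnit_unique _ _))

end Fibre

section Dagger

/-- A dagger on a category: an involutive identity-on-objects contravariant functor. -/
@[ext]
structure DaggerStructure (K : Type u) [Category.{v} K] where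
  dag : ∀ {X Y : K}, (X ⟶ Y) → (Y ⟶ X)
  dag_id : ∀ X : K, dag (𝟙 X) = 𝟙 X
  dag_comp : ∀ {X Y Z : K} (f : X ⟶ Y) (g : Y ⟶ Z), dag (f ≫ g) = dag g ≫ dag f
  dag_dag : ∀ {X Y : K} (f : X ⟶ Y), dag (dag f) = f

/-- A biproduct is a `†`-biproduct when the daggers of its projections are its injections. -/
def DaggerStructure.IsDaggerBiproduct {K : Type u} [Category.{v} K] [HasZeroMorphisms K]
    (S : DaggerStructure K) {X Y : K} (b : BinaryBicone X Y) : Prop :=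
  S.dag b.fst = b.inl ∧ S.dag b.snd = b.inr

variable {C : Type u} [Category.{v} C] [CartesianMonoidalCategory C] [CartesianLeftAdditive C]

/-- A functor, stationary on objects, from the total category of the simple linear fibration to
that of its dual, which commutes with the projections to `C`. -/
@[ext]
structure FunctorToDual (𝒟 : DiffCombinator C) where
  map : ∀ {X Y : LinTotal 𝒟}, (X ⟶ Y) → ((⟨X.base, X.fib⟩ : LinDual 𝒟) ⟶ ⟨Y.base, Y.fib⟩)
  map_id : ∀ X : LinTotal 𝒟, map (𝟙 X) = 𝟙 _
  map_comp : ∀ {X Y Z : LinTotal 𝒟} (φ : X ⟶ Y) (ψ : Y ⟶ Z), map (φ ≫ ψ) = map φ ≫ map ψ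
  map_base : ∀ {X Y : LinTotal 𝒟} (φ : X ⟶ Y), (dualProj 𝒟).map (map φ) = (linProj 𝒟).map φ

/-- The underlying functor of a `FunctorToDual`. -/
def FunctorToDual.toFunctor {𝒟 : DiffCombinator C} (H : FunctorToDual 𝒟) :
    LinTotal 𝒟 ⥤ LinDual 𝒟 where
  obj X := ⟨X.base, X.fib⟩
  map φ := H.map φ
  map_id := H.map_id
  map_comp := H.map_comp

/-- The action on maps of the functor between the dual fibrations that is induced by a morphism of
fibrations `H` which preserves the cloven Cartesian arrows, where the double dual is identified
with the simple linear fibration itself. The map `(f, g)` of the dual is the class of the span of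
the vertical arrow `(1, g)` and of the cloven Cartesian arrow `(f, π₁)`; it is sent to the class of
the span of their images. If `(1, h)` is the image of `(1, g)`, then this class is `(f, h)`. -/
def FunctorToDual.dualMap {𝒟 : DiffCombinator C} (H : FunctorToDual 𝒟) {X Y : LinDual 𝒟}
    (φ : X ⟶ Y) : (⟨X.base, X.fib⟩ : LinTotal 𝒟) ⟶ ⟨Y.base, Y.fib⟩ :=
  (⟨φ.base, (H.map (LinTotal.vert φ.fib φ.linear)).fib,
    (H.map (LinTotal.vert φ.fib φ.linear)).linear⟩ : LinTotal.Hom _ _)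

/-- A dagger fibration structure, with a dagger cleavage, on the simple linear fibration: a
morphism of fibrations to the dual fibration, stationary on objects, which sends cloven Cartesian
arrows to cloven Cartesian arrows, and whose composite with the induced morphism on the duals is the
identity. -/
@[ext]
structure LinearDaggerFibration (𝒟 : DiffCombinator C) extends FunctorToDual 𝒟 where
  map_isStronglyCartesian : ∀ {X Y : LinTotal 𝒟} (φ : X ⟶ Y),
    (linProj 𝒟).IsStronglyCartesian ((linProj 𝒟).map φ) φ →
      (dualProj 𝒟).IsStronglyCartesian ((dualProj 𝒟).map (map φ)) (map φ)
  map_cart : ∀ {I J : C} (f : I ⟶ J) (A : C), map (LinTotal.cart 𝒟 f A) = LinDual.cart 𝒟 f A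
  dualMap_map : ∀ {X Y : LinTotal 𝒟} (φ : X ⟶ Y), toFunctorToDual.dualMap (map φ) = φ

variable {𝒟 : DiffCombinator C}

/-- For `g : I × A ⟶ B` linear in `A`, the map `g^{†[I]} : I × B ⟶ A`. -/
def LinearDaggerFibration.dagger (S : LinearDaggerFibration 𝒟) {I A B : C} (g : I ⊗ A ⟶ B)
    (hg : 𝒟.IsLinearIn g) : I ⊗ B ⟶ A :=
  (S.map (LinTotal.vert g hg)).fib

lemma LinearDaggerFibration.dagger_linear (S : LinearDaggerFibration 𝒟) {I A B : C}
    (g : I ⊗ A ⟶ B) (hg : 𝒟.IsLinearIn g) : 𝒟.IsLinearIn (S.dagger g hg) :=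
  (S.map (LinTotal.vert g hg)).linear

/-- The dagger `†[I]` on the fibre over `I`. -/
def LinearDaggerFibration.fibreDagger (S : LinearDaggerFibration 𝒟) (I : C) :
    DaggerStructure (LinFibre 𝒟 I) where
  dag g := ⟨S.dagger g.1 g.2, S.dagger_linear g.1 g.2⟩
  dag_id A := by
    apply Subtype.ext
    exact congrArg LinDual.Hom.fib (S.map_id (⟨I, A.obj⟩ : LinTotal 𝒟))
  dag_comp {A B E} g h := by
    apply Subtype.ext
    have e : LinTotal.vert (g ≫ h).1 (g ≫ h).2 = LinTotal.vert g.1 g.2 ≫ LinTotal.vert h.1 h.2 := by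
      apply LinTotal.Hom.ext
      · exact (Category.id_comp _).symm
      · change lift (fst _ _) g.1 ≫ h.1 = lift (fst _ _ ≫ 𝟙 I) g.1 ≫ h.1
        rw [Category.comp_id]
    have h1 : S.dagger (g ≫ h).1 (g ≫ h).2 =
        lift (fst _ _) (lift (fst _ _ ≫ (S.map (LinTotal.vert g.1 g.2)).base) (snd _ _)) ≫
          (𝟙 _ ⊗ₘ S.dagger h.1 h.2) ≫ S.dagger g.1 g.2 := by
      unfold LinearDaggerFibration.dagger
      rw [e, S.map_comp]
      rfl
    have h2 : (S.map (LinTotal.vert g.1 g.2)).base = 𝟙 I := S.map_base (LinTotal.vert g.1 g.2)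
    rw [h2, Category.comp_id, lift_map_assoc, lift_fst_snd, Category.comp_id,
      Category.id_comp] at h1
    exact h1
  dag_dag g := by
    apply Subtype.ext
    exact congrArg LinTotal.Hom.fib (S.dualMap_map (LinTotal.vert g.1 g.2))

/-- A contextual linear dagger: a dagger fibration structure (with a dagger cleavage) on the simple
linear fibration, such that every fibre `Lin(C)[I]` has `†`-biproducts. -/
@[ext]
structure ContextualLinearDagger (𝒟 : DiffCombinator C) extends LinearDaggerFibration 𝒟 where
  daggerBiproducts : ∀ (I : C) (A B : LinFibre 𝒟 I),
    (toLinearDaggerFibration.fibreDagger I).IsDaggerBiproduct (LinFibre.bicone A B)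

end Dagger

end RevDiff

open RevDiff

/-!
Both constructions are instances of one operation. For `g : I × A ⟶ B` the *transpose*
`(⟨1, 0⟩ × 1) R[g] π₁ : I × B ⟶ A` is the reverse derivative of `g` in the variable `A`, taken at
the zero vector. By the reverse chain rule, transposition reverses the composition of the simple
fibration (`ReverseDiffCombinator.lift_transpose_comp`), as long as the first factor vanishes at
zero vectors.

*From `R` to `(D, †)`.* The derivative `D[f]` is the transpose of `R[f]`. As `R[fg]` is a composite
in the simple fibration, the chain rule for `D` follows from the functoriality of transposition.
The sixth reverse axiom says that `R[f]` is `D`-linear in its second variable, and hence so is every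
transpose; the seventh says that `D[D[f]]` is invariant under exchange. On linear maps,
transposition is involutive (`ReverseDiffCombinator.transpose_transpose`): differentiating the
transpose of `g` backwards once more gives `R[R[g]]`, which computes `D[g]`, which is `g`. Hence it
is a contextual linear dagger; the preservation of all Cartesian arrows follows from that of the
cloven ones.

*From `(D, †)` to `R`.* Put `R[f] = D[f]†`. As the biproducts are `†`-biproducts, the dagger turns
pairings into copairings (`ContextualLinearDagger.lift_dagger_lift`) and is therefore additive; its
functoriality is the reverse chain rule. The key point is that for linear `g` the transpose formed
with this `R` is `g†` (`ContextualLinearDagger.transpose_R`). Applied to `R[f]`, which is linear as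
a dagger, it shows that the transpose of `R[f]` is `D[f]†† = D[f]`, so that the last two reverse
axioms are the linearity of `R[f]` and the symmetry of `D[D[f]]`.

The same identities show that the two constructions are mutually inverse.
-/

namespace RevDiff

-- Together with `← Category.assoc`, these lemmas evaluate a map on a generalized element: in a
-- composite associated to the left, the maps are applied to the element one after the other.
attribute [local simp] CartesianLeftAdditive.comp_add CartesianLeftAdditive.comp_zero
  CartesianLeftAdditive.add_comp_fst CartesianLeftAdditive.zero_comp_fst
  CartesianLeftAdditive.add_comp_snd CartesianLeftAdditive.zero_comp_snd
  comp_lift lift_ι₀ lift_ι₁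

variable {C : Type u} [Category.{v} C] [CartesianMonoidalCategory C]

/-! ### Generalized elements -/

lemma hom_ext_lift {A B E : C} {f g : A ⊗ B ⟶ E}
    (h : ∀ {X : C} (a : X ⟶ A) (b : X ⟶ B), lift a b ≫ f = lift a b ≫ g) : f = g := by
  simpa using h (fst A B) (snd A B)

variable [CartesianLeftAdditive C]

/-! ### From a reverse differential combinator to a differential combinator -/

namespace ReverseDiffCombinator

variable (ℛ : ReverseDiffCombinator C)

lemma lift_R_comp {X A B B' : C} (a : X ⟶ A) (b : X ⟶ B') (f : A ⟶ B) (g : B ⟶ B') :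
    lift a b ≫ ℛ.R (f ≫ g) = lift a (lift (a ≫ f) b ≫ ℛ.R g) ≫ ℛ.R f := by
  simp [ℛ.R_comp, ← Category.assoc]

lemma lift_R_lift {X A B B' : C} (a : X ⟶ A) (b : X ⟶ B ⊗ B') (f : A ⟶ B) (g : A ⟶ B') :
    lift a b ≫ ℛ.R (lift f g) = lift a (b ≫ fst B B') ≫ ℛ.R f + lift a (b ≫ snd B B') ≫ ℛ.R g := by
  simp [ℛ.R_lift, ← Category.assoc]

lemma lift_R_fst {X A B : C} (a : X ⟶ A ⊗ B) (b : X ⟶ A) :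
    lift a b ≫ ℛ.R (fst A B) = lift b 0 := by
  simp [ℛ.R_fst]

lemma lift_R_snd {X A B : C} (a : X ⟶ A ⊗ B) (b : X ⟶ B) :
    lift a b ≫ ℛ.R (snd A B) = lift 0 b := by
  simp [ℛ.R_snd]

lemma lift_R_id {X A : C} (a b : X ⟶ A) : lift a b ≫ ℛ.R (𝟙 A) = b := by
  simp [ℛ.R_id]

/-- The transpose `(⟨1, 0⟩ × 1) R[g] π₁` in the context `I` of a map `g : I × A ⟶ B`: the part of
the reverse derivative of `g` at the point `(i, 0)` that concerns the variable `A`. -/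
def transpose {I A B : C} (g : I ⊗ A ⟶ B) : I ⊗ B ⟶ A :=
  (ι₀ I A ⊗ₘ 𝟙 B) ≫ ℛ.R g ≫ snd I A

lemma lift_transpose {X I A B : C} (i : X ⟶ I) (b : X ⟶ B) (g : I ⊗ A ⟶ B) :
    lift i b ≫ ℛ.transpose g = (lift (lift i 0) b ≫ ℛ.R g) ≫ snd I A := by
  simp [transpose, ← Category.assoc]

lemma transpose_add {I A B : C} (g h : I ⊗ A ⟶ B) :
    ℛ.transpose (g + h) = ℛ.transpose g + ℛ.transpose h := by
  apply hom_ext_lift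
  intro X a b
  simp [lift_transpose, ℛ.R_add]

lemma transpose_zero (I A B : C) : ℛ.transpose (0 : I ⊗ A ⟶ B) = 0 := by
  apply hom_ext_lift
  intro X a b
  simp [lift_transpose, ℛ.R_zero]

lemma transpose_snd (I A : C) : ℛ.transpose (snd I A) = snd I A := by
  apply hom_ext_lift
  intro X a b
  simp [lift_transpose, lift_R_snd]

lemma transpose_snd_comp (I : C) {A B : C} (f : A ⟶ B) :
    ℛ.transpose (snd I A ≫ f) = lift 0 (snd I B) ≫ ℛ.R f := by
  apply hom_ext_lift
  intro X a b
  simp [lift_transpose, lift_R_comp, lift_R_snd, ← Category.assoc]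

/-- Transposition reverses the composition of the simple fibration. That `g` vanishes at the zero
vector is what allows the reverse derivative of `g'` to be taken at a point of the form
`(j, 0)`. -/
lemma lift_transpose_comp {X I J A B E : C} (i : X ⟶ I) (c : X ⟶ E) (f : I ⟶ J)
    (g : I ⊗ A ⟶ B) (g' : J ⊗ B ⟶ E) (hg : lift i 0 ≫ g = 0) :
    lift i c ≫ ℛ.transpose (lift (fst I A ≫ f) g ≫ g') =
      lift i (lift (i ≫ f) c ≫ ℛ.transpose g') ≫ ℛ.transpose g := by
  simp [lift_transpose, lift_R_comp, lift_R_lift, lift_R_fst, hg, ← Category.assoc]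

/-- The differential combinator of a reverse differential combinator, `D[f]` being the transpose
of `R[f]`. -/
def D {A B : C} (f : A ⟶ B) : A ⊗ A ⟶ B := ℛ.transpose (ℛ.R f)

lemma lift_D {X A B : C} (a v : X ⟶ A) (f : A ⟶ B) :
    lift a v ≫ ℛ.D f = (lift (lift a 0) v ≫ ℛ.R (ℛ.R f)) ≫ snd A B :=
  ℛ.lift_transpose a v (ℛ.R f)

lemma D_add {A B : C} (f g : A ⟶ B) : ℛ.D (f + g) = ℛ.D f + ℛ.D g := by
  simp [D, ℛ.R_add, transpose_add]

lemma D_zero (A B : C) : ℛ.D (0 : A ⟶ B) = 0 := by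
  simp [D, ℛ.R_zero, transpose_zero]

lemma D_id (A : C) : ℛ.D (𝟙 A) = snd A A := by
  simp [D, ℛ.R_id, transpose_snd]

lemma lift_R_ι₀ {X A B : C} (a : X ⟶ A) (b : X ⟶ A ⊗ B) :
    lift a b ≫ ℛ.R (ι₀ A B) = b ≫ fst A B := by
  simp [ι₀, lift_R_lift, lift_R_id, ℛ.R_zero]

lemma lift_R_ι₁ {X A B : C} (a : X ⟶ B) (b : X ⟶ A ⊗ B) :
    lift a b ≫ ℛ.R (ι₁ A B) = b ≫ snd A B := by
  simp [ι₁, lift_R_lift, lift_R_id, ℛ.R_zero]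

lemma D_fst (A B : C) : ℛ.D (fst A B) = snd (A ⊗ B) (A ⊗ B) ≫ fst A B := by
  apply hom_ext_lift
  intro X a b
  rw [D, ℛ.R_fst, transpose_snd_comp]
  simp [lift_R_ι₀, ← Category.assoc]

lemma D_snd (A B : C) : ℛ.D (snd A B) = snd (A ⊗ B) (A ⊗ B) ≫ snd A B := by
  apply hom_ext_lift
  intro X a b
  rw [D, ℛ.R_snd, transpose_snd_comp]
  simp [lift_R_ι₁, ← Category.assoc]

/-- The chain rule. Both `R[fg]` and its transpose are composites in the simple fibration, so that
it follows from the functoriality of transposition. -/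
lemma D_comp {A B B' : C} (f : A ⟶ B) (g : B ⟶ B') :
    ℛ.D (f ≫ g) = lift (fst A A ≫ f) (ℛ.D f) ≫ ℛ.D g := by
  apply hom_ext_lift
  intro X a v
  have h : ℛ.R (f ≫ g) =
      lift (fst A B' ≫ 𝟙 A) (lift (fst A B' ≫ f) (snd A B') ≫ ℛ.R g) ≫ ℛ.R f := by
    rw [ℛ.R_comp, lift_map_assoc]
  have h0 : lift a 0 ≫ lift (fst A B' ≫ f) (snd A B') ≫ ℛ.R g = 0 := by
    simp [← Category.assoc, ℛ.zero_R]
  rw [D, h, ℛ.lift_transpose_comp _ _ _ _ _ h0, ℛ.lift_transpose_comp _ _ _ _ _ (by simp),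
    transpose_snd]
  simp [D, ← Category.assoc]

lemma D_lift {A B B' : C} (f : A ⟶ B) (g : A ⟶ B') :
    ℛ.D (lift f g) = lift (ℛ.D f) (ℛ.D g) := by
  have hf : (𝟙 A ⊗ₘ fst B B') ≫ ℛ.R f =
      lift (fst A (B ⊗ B') ≫ 𝟙 A) (snd A (B ⊗ B') ≫ fst B B') ≫ ℛ.R f := by
    congr 1; apply CartesianMonoidalCategory.hom_ext <;> simp
  have hg : (𝟙 A ⊗ₘ snd B B') ≫ ℛ.R g =
      lift (fst A (B ⊗ B') ≫ 𝟙 A) (snd A (B ⊗ B') ≫ snd B B') ≫ ℛ.R g := by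
    congr 1; apply CartesianMonoidalCategory.hom_ext <;> simp
  apply hom_ext_lift
  intro X a v
  rw [D, ℛ.R_lift, hf, hg, transpose_add, CartesianLeftAdditive.comp_add,
    ℛ.lift_transpose_comp _ _ _ _ _ (by simp [← Category.assoc]),
    ℛ.lift_transpose_comp _ _ _ _ _ (by simp [← Category.assoc]),
    transpose_snd_comp, transpose_snd_comp]
  simp [D, lift_R_fst, lift_R_snd, ← lift_add]

/-- The sixth axiom of a reverse differential combinator says that reverse derivatives are linear
in their second variable. -/
lemma lift_D_R {X A B : C} (a : X ⟶ A) (b c : X ⟶ B) (f : A ⟶ B) :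
    lift (lift a b) (lift 0 c) ≫ ℛ.D (ℛ.R f) = lift a c ≫ ℛ.R f := by
  have h := congrArg (fun k => lift a (lift b c) ≫ k) (ℛ.R_linear f)
  simpa [lift_D, ← Category.assoc] using h

lemma transpose_eq {I A B : C} (g : I ⊗ A ⟶ B) :
    ℛ.transpose g = lift (lift (fst I B) 0) (snd I B) ≫ ℛ.R g ≫ snd I A := by
  apply hom_ext_lift
  intro X a b
  simp [lift_transpose, ← Category.assoc]

/-- Transposes are linear in their second variable, whether or not the given map is. -/
lemma lift_D_transpose {X I A B : C} (a : X ⟶ I) (b c : X ⟶ B) (g : I ⊗ A ⟶ B) :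
    lift (lift a b) (lift 0 c) ≫ ℛ.D (ℛ.transpose g) = lift a c ≫ ℛ.transpose g := by
  rw [transpose_eq]
  simp [D_comp, D_lift, D_fst, D_snd, D_zero, lift_D_R, lift_zero, ← Category.assoc]

/-- The differential combinator of a reverse differential combinator. -/
def toDiffCombinator : DiffCombinator C where
  D f := ℛ.D f
  D_add := ℛ.D_add
  D_zero := ℛ.D_zero
  add_D a b c f := by simp [lift_D, ℛ.add_R]
  zero_D a f := by simp [lift_D, ℛ.zero_R]
  D_id := ℛ.D_id
  D_fst := ℛ.D_fst
  D_snd := ℛ.D_snd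
  D_lift := ℛ.D_lift
  D_comp := ℛ.D_comp
  D_D_linear a b c f := ℛ.lift_D_transpose a b c (ℛ.R f)
  D_D_symm {X A B} a b c d f := by
    -- the seventh axiom of `ℛ` is the invariance of `D[D[f]]` under exchange
    have h : ℛ.D (ℛ.D f) = ex A A A A ≫ ℛ.D (ℛ.D f) := ℛ.R_symm f
    have hex : lift (lift a b) (lift c d) ≫ ex A A A A = lift (lift a c) (lift b d) := by
      simp [ex]
    rw [h, ← Category.assoc, hex, ← h]

lemma toDiffCombinator_D {A B : C} (f : A ⟶ B) : ℛ.toDiffCombinator.D f = ℛ.D f := rfl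

lemma isLinearIn_R {A B : C} (f : A ⟶ B) : ℛ.toDiffCombinator.IsLinearIn (ℛ.R f) :=
  (DiffCombinator.isLinearIn_iff _).2 fun a b c => ℛ.lift_D_R a b c f

lemma isLinearIn_transpose {I A B : C} (g : I ⊗ A ⟶ B) :
    ℛ.toDiffCombinator.IsLinearIn (ℛ.transpose g) :=
  (DiffCombinator.isLinearIn_iff _).2 fun a b c => ℛ.lift_D_transpose a b c g

/-- Transposition is involutive on linear maps: the reverse derivative of the transpose of `g` is
computed by `R[R[g]]`, hence by `D[g]`, which is `g` itself when `g` is linear. -/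
lemma transpose_transpose {I A B : C} (g : I ⊗ A ⟶ B)
    (hg : ℛ.toDiffCombinator.IsLinearIn g) : ℛ.transpose (ℛ.transpose g) = g := by
  apply hom_ext_lift
  intro X a b
  have hD := (DiffCombinator.isLinearIn_iff g).1 hg a 0 b
  rw [toDiffCombinator_D, lift_D] at hD
  rw [← hD, lift_transpose, transpose_eq]
  simp [lift_R_comp, lift_R_lift, lift_R_fst, lift_R_snd, ℛ.R_zero, ← Category.assoc]

end ReverseDiffCombinator

/-! ### Functors to the dual fibration -/

/-- The factorization of a map of the simple linear fibration into a vertical arrow and a cloven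
Cartesian arrow. -/
lemma LinTotal.vert_comp_cart {𝒟 : DiffCombinator C} {X Y : LinTotal 𝒟} (φ : X ⟶ Y) :
    LinTotal.vert φ.fib φ.linear ≫ LinTotal.cart 𝒟 φ.base Y.fib = φ := by
  apply LinTotal.Hom.ext
  · exact Category.id_comp _
  · exact lift_snd _ _

lemma LinDual.comp_fib {𝒟 : DiffCombinator C} {X Y Z : LinDual 𝒟} (φ : X ⟶ Y) (ψ : Y ⟶ Z) :
    (φ ≫ ψ).fib = lift (fst _ _) (lift (fst _ _ ≫ φ.base) (snd _ _) ≫ ψ.fib) ≫ φ.fib := by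
  change lift _ _ ≫ (𝟙 _ ⊗ₘ ψ.fib) ≫ φ.fib = _
  rw [lift_map_assoc, Category.comp_id]

/-- A functor over the base that preserves the cloven Cartesian arrows preserves all Cartesian
arrows, for each of these is a vertical isomorphism followed by a cloven one. -/
lemma FunctorToDual.map_isStronglyCartesian_of_map_cart {𝒟 : DiffCombinator C}
    (H : FunctorToDual 𝒟)
    (hH : ∀ {I J : C} (f : I ⟶ J) (A : C), H.map (LinTotal.cart 𝒟 f A) = LinDual.cart 𝒟 f A)
    {X Y : LinTotal 𝒟} (φ : X ⟶ Y)
    (hφ : (linProj 𝒟).IsStronglyCartesian ((linProj 𝒟).map φ) φ) :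
    (dualProj 𝒟).IsStronglyCartesian ((dualProj 𝒟).map (H.map φ)) (H.map φ) := by
  obtain ⟨I, A⟩ := X
  obtain ⟨J, B⟩ := Y
  let ν : (⟨I, A⟩ : LinTotal 𝒟) ⟶ ⟨I, B⟩ := LinTotal.vert φ.fib φ.linear
  let κ : (⟨I, B⟩ : LinTotal 𝒟) ⟶ ⟨J, B⟩ := LinTotal.cart 𝒟 φ.base B
  have hνκ : ν ≫ κ = φ := LinTotal.vert_comp_cart φ
  have hκ : (linProj 𝒟).IsStronglyCartesian φ.base κ := LinTotal.cart_isStronglyCartesian 𝒟 _ B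
  have hν : (linProj 𝒟).IsHomLift (𝟙 I) ν :=
    (linProj_isHomLift_iff (X := ⟨I, A⟩) (Y := ⟨I, B⟩) (𝟙 I) ν).2 rfl
  have hcomp : (linProj 𝒟).IsStronglyCartesian (𝟙 I ≫ φ.base) (ν ≫ κ) := by
    rw [hνκ, Category.id_comp]
    exact hφ
  have hν' : (linProj 𝒟).IsStronglyCartesian (𝟙 I) ν :=
    Functor.IsStronglyCartesian.of_comp (linProj 𝒟) (g := φ.base) (ψ := κ)
  have hiso : IsIso ν := Functor.IsStronglyCartesian.isIso_of_base_isIso (linProj 𝒟) (𝟙 I) ν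
  have hiso' : IsIso (H.map ν) := inferInstanceAs (IsIso (H.toFunctor.map ν))
  have hmap : H.map φ = H.map ν ≫ LinDual.cart 𝒟 φ.base B := by
    rw [← hH, ← H.map_comp, hνκ]
  have h1 := Functor.IsStronglyCartesian.of_isIso (dualProj 𝒟) ((dualProj 𝒟).map (H.map ν))
    (H.map ν)
  have h2 : (dualProj 𝒟).IsStronglyCartesian
      ((dualProj 𝒟).map (LinDual.cart 𝒟 φ.base B)) (LinDual.cart 𝒟 φ.base B) :=
    LinDual.cart_isStronglyCartesian 𝒟 φ.base B
  rw [hmap, Functor.map_comp]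
  infer_instance

/-! ### The contextual linear dagger of a reverse differential combinator -/

/-- Transposition, as a contextual linear dagger. -/
def ReverseDiffCombinator.toDagger (ℛ : ReverseDiffCombinator C) :
    ContextualLinearDagger ℛ.toDiffCombinator :=
  let H : FunctorToDual ℛ.toDiffCombinator :=
    { map := fun φ => (⟨φ.base, ℛ.transpose φ.fib, ℛ.isLinearIn_transpose φ.fib⟩ :
        LinDual.Hom _ _)
      map_id := fun X => LinDual.Hom.ext rfl (ℛ.transpose_snd X.base X.fib)
      map_comp := fun φ ψ => by
        apply LinDual.Hom.ext
        · rfl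
        · rw [LinDual.comp_fib]
          apply hom_ext_lift
          intro X i c
          refine (ℛ.lift_transpose_comp i c φ.base φ.fib ψ.fib (φ.linear.map_zero i)).trans ?_
          simp [← Category.assoc]
      map_base := fun _ => rfl }
  have hH : ∀ {I J : C} (f : I ⟶ J) (A : C),
      H.map (LinTotal.cart ℛ.toDiffCombinator f A) = LinDual.cart ℛ.toDiffCombinator f A :=
    fun {I J} f A => LinDual.Hom.ext rfl (ℛ.transpose_snd I A)
  { toFunctorToDual := H
    map_isStronglyCartesian := H.map_isStronglyCartesian_of_map_cart hH
    map_cart := hH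
    dualMap_map := fun φ => LinTotal.Hom.ext rfl (ℛ.transpose_transpose φ.fib φ.linear)
    daggerBiproducts := fun I A B => by
      refine ⟨Subtype.ext ?_, Subtype.ext ?_⟩
      · refine (ℛ.transpose_snd_comp I (fst A.obj B.obj)).trans ?_
        simp [lift_R_fst, LinFibre.bicone]
      · refine (ℛ.transpose_snd_comp I (snd A.obj B.obj)).trans ?_
        simp [lift_R_snd, LinFibre.bicone] }

/-! ### The algebra of a contextual linear dagger -/

lemma DiffCombinator.isLinearIn_snd_fst {𝒟 : DiffCombinator C} (I A B : C) :
    𝒟.IsLinearIn (snd I (A ⊗ B) ≫ fst A B) :=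
  (LinFibre.bicone (⟨A⟩ : LinFibre 𝒟 I) ⟨B⟩).fst.2

lemma DiffCombinator.isLinearIn_snd_snd {𝒟 : DiffCombinator C} (I A B : C) :
    𝒟.IsLinearIn (snd I (A ⊗ B) ≫ snd A B) :=
  (LinFibre.bicone (⟨A⟩ : LinFibre 𝒟 I) ⟨B⟩).snd.2

lemma DiffCombinator.isLinearIn_snd_ι₀ {𝒟 : DiffCombinator C} (I A B : C) :
    𝒟.IsLinearIn (snd I A ≫ ι₀ A B) :=
  (LinFibre.bicone (⟨A⟩ : LinFibre 𝒟 I) ⟨B⟩).inl.2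

lemma DiffCombinator.isLinearIn_snd_ι₁ {𝒟 : DiffCombinator C} (I A B : C) :
    𝒟.IsLinearIn (snd I B ≫ ι₁ A B) :=
  (LinFibre.bicone (⟨A⟩ : LinFibre 𝒟 I) ⟨B⟩).inr.2

namespace LinearDaggerFibration

variable {𝒟 : DiffCombinator C} (S : LinearDaggerFibration 𝒟)

/-- The functor is determined by its action on vertical arrows. -/
lemma map_fib {X Y : LinTotal 𝒟} (φ : X ⟶ Y) : (S.map φ).fib = S.dagger φ.fib φ.linear := by
  have h : S.map φ = S.map (LinTotal.vert φ.fib φ.linear) ≫ LinDual.cart 𝒟 φ.base Y.fib := by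
    rw [← S.map_cart, ← S.map_comp, LinTotal.vert_comp_cart]
  rw [h, LinDual.comp_fib]
  change lift _ (lift _ _ ≫ snd _ _) ≫ S.dagger φ.fib φ.linear = _
  simp

lemma map_base_eq {X Y : LinTotal 𝒟} (φ : X ⟶ Y) : (S.map φ).base = φ.base := S.map_base φ

/-- Functoriality, in terms of generalized elements: the dagger reverses the composition of the
simple fibration. The composite is a variable `k`, so that a map can be factored without rewriting
under the proof of its linearity. -/
lemma lift_dagger_comp {X I J A B E : C} (i : X ⟶ I) (c : X ⟶ E) (f : I ⟶ J)
    {g : I ⊗ A ⟶ B} (hg : 𝒟.IsLinearIn g) {g' : J ⊗ B ⟶ E} (hg' : 𝒟.IsLinearIn g')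
    {k : I ⊗ A ⟶ E} (hk : 𝒟.IsLinearIn k) (e : k = lift (fst I A ≫ f) g ≫ g') :
    lift i c ≫ S.dagger k hk =
      lift i (lift (i ≫ f) c ≫ S.dagger g' hg') ≫ S.dagger g hg := by
  subst e
  let φ : (⟨I, A⟩ : LinTotal 𝒟) ⟶ ⟨J, B⟩ := (⟨f, g, hg⟩ : LinTotal.Hom _ _)
  let ψ : (⟨J, B⟩ : LinTotal 𝒟) ⟶ ⟨J, E⟩ := LinTotal.vert g' hg'
  have h : S.dagger (lift (fst I A ≫ f) g ≫ g') hk =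
      lift (fst I E) (lift (fst I E ≫ f) (snd I E) ≫ S.dagger g' hg') ≫ S.dagger g hg := by
    refine (S.map_fib (φ ≫ ψ)).symm.trans ?_
    rw [S.map_comp, LinDual.comp_fib, S.map_fib, S.map_fib, S.map_base_eq]
    rfl
  rw [h]
  simp [← Category.assoc]

lemma dagger_congr {I A B : C} {g h : I ⊗ A ⟶ B} (e : g = h) (hg : 𝒟.IsLinearIn g)
    (hh : 𝒟.IsLinearIn h) : S.dagger g hg = S.dagger h hh := by
  subst e
  rfl

lemma dagger_dagger {I A B : C} (g : I ⊗ A ⟶ B) (hg : 𝒟.IsLinearIn g) :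
    S.dagger (S.dagger g hg) (S.dagger_linear g hg) = g :=
  congrArg LinTotal.Hom.fib (S.dualMap_map (LinTotal.vert g hg))

lemma dagger_snd {I A : C} (h : 𝒟.IsLinearIn (snd I A)) : S.dagger (snd I A) h = snd I A :=
  congrArg LinDual.Hom.fib (S.map_id (⟨I, A⟩ : LinTotal 𝒟))

lemma dagger_zero {I A B : C} (h : 𝒟.IsLinearIn (0 : I ⊗ A ⟶ B)) :
    S.dagger (0 : I ⊗ A ⟶ B) h = 0 := by
  apply hom_ext_lift
  intro X i c
  -- the zero map factors through the terminal object
  rw [S.lift_dagger_comp i c (𝟙 I) (DiffCombinator.isLinearIn_zero I A (𝟙_ C))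
    (DiffCombinator.isLinearIn_zero I (𝟙_ C) B) h (by simp),
    toUnit_unique (_ ≫ S.dagger (0 : I ⊗ 𝟙_ C ⟶ B) _) 0, (S.dagger_linear _ _).map_zero]
  simp

end LinearDaggerFibration

namespace ContextualLinearDagger

variable {𝒟 : DiffCombinator C} (S : ContextualLinearDagger 𝒟)

lemma dagger_snd_fst {I A B : C} (h : 𝒟.IsLinearIn (snd I (A ⊗ B) ≫ fst A B)) :
    S.dagger (snd I (A ⊗ B) ≫ fst A B) h = snd I A ≫ ι₀ A B :=
  congrArg Subtype.val (S.daggerBiproducts I ⟨A⟩ ⟨B⟩).1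

lemma dagger_snd_snd {I A B : C} (h : 𝒟.IsLinearIn (snd I (A ⊗ B) ≫ snd A B)) :
    S.dagger (snd I (A ⊗ B) ≫ snd A B) h = snd I B ≫ ι₁ A B :=
  congrArg Subtype.val (S.daggerBiproducts I ⟨A⟩ ⟨B⟩).2

lemma dagger_ι₀ {I A B : C} (h : 𝒟.IsLinearIn (snd I A ≫ ι₀ A B)) :
    S.dagger (snd I A ≫ ι₀ A B) h = snd I (A ⊗ B) ≫ fst A B := by
  rw [← S.dagger_dagger _ (DiffCombinator.isLinearIn_snd_fst I A B)]
  exact S.dagger_congr (S.dagger_snd_fst _).symm _ _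

lemma dagger_ι₁ {I A B : C} (h : 𝒟.IsLinearIn (snd I B ≫ ι₁ A B)) :
    S.dagger (snd I B ≫ ι₁ A B) h = snd I (A ⊗ B) ≫ snd A B := by
  rw [← S.dagger_dagger _ (DiffCombinator.isLinearIn_snd_snd I A B)]
  exact S.dagger_congr (S.dagger_snd_snd _).symm _ _

/-- The dagger of a pairing is a copairing. -/
lemma lift_dagger_lift {X I A B B' : C} (i : X ⟶ I) (c : X ⟶ B ⊗ B') {g : I ⊗ A ⟶ B}
    (hg : 𝒟.IsLinearIn g) {h : I ⊗ A ⟶ B'} (hh : 𝒟.IsLinearIn h)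
    (hgh : 𝒟.IsLinearIn (lift g h)) :
    lift i c ≫ S.dagger (lift g h) hgh =
      lift i (c ≫ fst B B') ≫ S.dagger g hg + lift i (c ≫ snd B B') ≫ S.dagger h hh := by
  have hc : c = lift (c ≫ fst B B') 0 + lift 0 (c ≫ snd B B') := by
    rw [← lift_add]
    simp
  -- the two summands are the daggers of the components of the pairing
  rw [S.lift_dagger_comp i (c ≫ fst B B') (𝟙 I) hgh
      (DiffCombinator.isLinearIn_snd_fst I B B') hg (by simp),
    S.lift_dagger_comp i (c ≫ snd B B') (𝟙 I) hgh
      (DiffCombinator.isLinearIn_snd_snd I B B') hh (by simp),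
    dagger_snd_fst, dagger_snd_snd]
  nth_rw 1 [hc]
  rw [(S.dagger_linear _ _).map_add]
  simp

/-- The dagger is additive, as a sum is a pairing followed by a codiagonal, whose daggers are a
copairing and a diagonal. -/
lemma dagger_add {I A B : C} {g h : I ⊗ A ⟶ B} (hg : 𝒟.IsLinearIn g) (hh : 𝒟.IsLinearIn h)
    (hgh : 𝒟.IsLinearIn (g + h)) :
    S.dagger (g + h) hgh = S.dagger g hg + S.dagger h hh := by
  apply hom_ext_lift
  intro X i c
  have hs : 𝒟.IsLinearIn (snd I (B ⊗ B) ≫ fst B B + snd I (B ⊗ B) ≫ snd B B) :=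
    (DiffCombinator.isLinearIn_snd_fst I B B).add (DiffCombinator.isLinearIn_snd_snd I B B)
  -- `h0` and `h1` say that the components of the dagger of the codiagonal are identities, as the
  -- codiagonal restricts to the identity along both injections
  have h0 := S.lift_dagger_comp i c (𝟙 I) (DiffCombinator.isLinearIn_snd_ι₀ I B B) hs
    (DiffCombinator.isLinearIn_snd I B) (by simp [← Category.assoc])
  have h1 := S.lift_dagger_comp i c (𝟙 I) (DiffCombinator.isLinearIn_snd_ι₁ I B B) hs
    (DiffCombinator.isLinearIn_snd I B) (by simp [← Category.assoc])
  rw [S.dagger_snd, dagger_ι₀] at h0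
  rw [S.dagger_snd, dagger_ι₁] at h1
  rw [S.lift_dagger_comp i c (𝟙 I) (hg.lift hh) hs hgh (by simp [← Category.assoc]),
    S.lift_dagger_lift i _ hg hh]
  simp only [lift_snd, lift_snd_assoc] at h0 h1
  rw [← h0, ← h1, CartesianLeftAdditive.comp_add]

end ContextualLinearDagger

/-! ### From a contextual linear dagger to a reverse differential combinator -/

lemma DiffCombinator.ex_D_D (𝒟 : DiffCombinator C) {A B : C} (f : A ⟶ B) :
    𝒟.D (𝒟.D f) = ex A A A A ≫ 𝒟.D (𝒟.D f) := by
  apply hom_ext_lift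
  intro X p q
  have h := 𝒟.D_D_symm (p ≫ fst A A) (p ≫ snd A A) (q ≫ fst A A) (q ≫ snd A A) f
  simpa [ex, ← Category.assoc] using h

lemma DiffCombinator.isLinearIn_D (𝒟 : DiffCombinator C) {A B : C} (f : A ⟶ B) :
    𝒟.IsLinearIn (𝒟.D f) :=
  (DiffCombinator.isLinearIn_iff _).2 fun a b c => 𝒟.D_D_linear a b c f

namespace ContextualLinearDagger

variable {𝒟 : DiffCombinator C} (S : ContextualLinearDagger 𝒟)

/-- The reverse derivative: the dagger of the derivative. -/
def R {A B : C} (f : A ⟶ B) : A ⊗ B ⟶ A := S.dagger (𝒟.D f) (𝒟.isLinearIn_D f)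

lemma isLinearIn_R {A B : C} (f : A ⟶ B) : 𝒟.IsLinearIn (S.R f) := S.dagger_linear _ _

lemma dagger_R {A B : C} (f : A ⟶ B) : S.dagger (S.R f) (S.isLinearIn_R f) = 𝒟.D f :=
  S.dagger_dagger _ _

/-- The reverse derivative is computed from any expression for the derivative. -/
lemma R_eq {A B : C} (f : A ⟶ B) {g : A ⊗ A ⟶ B} (e : 𝒟.D f = g) (hg : 𝒟.IsLinearIn g) :
    S.R f = S.dagger g hg := S.dagger_congr e _ _

/-- On linear maps the dagger is transposition. Reindexing `R[g] = D[g]†` along `⟨1, 0⟩` and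
then projecting to the second variable is dual to restricting `D[g]` to the point `(i, 0)` and to
the vectors `(0, a)`, and `D[g]((i, 0), (0, a))` is `g(i, a)` when `g` is linear. -/
lemma transpose_R {I A B : C} (g : I ⊗ A ⟶ B) (hg : 𝒟.IsLinearIn g) :
    (ι₀ I A ⊗ₘ 𝟙 B) ≫ S.R g ≫ snd I A = S.dagger g hg := by
  apply hom_ext_lift
  intro X i b
  have hk : 𝒟.IsLinearIn (lift (fst I (I ⊗ A) ≫ ι₀ I A) (snd I (I ⊗ A)) ≫ 𝒟.D g) :=
    (DiffCombinator.isLinearIn_snd _ _).comp _ (𝒟.isLinearIn_D g)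
  have he : g = lift (fst I A ≫ 𝟙 I) (snd I A ≫ ι₁ I A) ≫
      lift (fst I (I ⊗ A) ≫ ι₀ I A) (snd I (I ⊗ A)) ≫ 𝒟.D g := by
    have h := (DiffCombinator.isLinearIn_iff g).1 hg (fst I A) 0 (snd I A)
    simpa [← Category.assoc] using h.symm
  rw [S.lift_dagger_comp i b (𝟙 I) (DiffCombinator.isLinearIn_snd_ι₁ I I A) hk hg he, dagger_ι₁,
    S.lift_dagger_comp _ b (ι₀ I A) (DiffCombinator.isLinearIn_snd _ _) (𝒟.isLinearIn_D g) hk rfl,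
    S.dagger_snd]
  simp [R, ← Category.assoc]

/-- Since `R[f]` is linear, its transpose is its dagger `D[f]`. -/
lemma D_eq {A B : C} (f : A ⟶ B) :
    𝒟.D f = (ι₀ A B ⊗ₘ 𝟙 A) ≫ S.R (S.R f) ≫ snd A B := by
  rw [S.transpose_R (S.R f) (S.isLinearIn_R f), dagger_R]

/-- The reverse differential combinator `R[f] = D[f]†` of a contextual linear dagger. -/
def toReverseDiffCombinator : ReverseDiffCombinator C where
  R f := S.R f
  R_add f g := by
    rw [S.R_eq (f + g) (𝒟.D_add f g) ((𝒟.isLinearIn_D f).add (𝒟.isLinearIn_D g)),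
      S.dagger_add (𝒟.isLinearIn_D f) (𝒟.isLinearIn_D g), R, R]
  R_zero A B := by
    rw [S.R_eq 0 (𝒟.D_zero A B) (DiffCombinator.isLinearIn_zero _ _ _), S.dagger_zero]
  add_R a b c f := (S.isLinearIn_R f).map_add a b c
  zero_R a f := (S.isLinearIn_R f).map_zero a
  R_id A := by
    rw [S.R_eq _ (𝒟.D_id A) (DiffCombinator.isLinearIn_snd _ _), S.dagger_snd]
  R_fst A B := by
    rw [S.R_eq _ (𝒟.D_fst A B) (DiffCombinator.isLinearIn_snd_fst _ _ _), dagger_snd_fst]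
  R_snd A B := by
    rw [S.R_eq _ (𝒟.D_snd A B) (DiffCombinator.isLinearIn_snd_snd _ _ _), dagger_snd_snd]
  R_lift f g := by
    apply hom_ext_lift
    intro X a b
    rw [S.R_eq _ (𝒟.D_lift f g) ((𝒟.isLinearIn_D f).lift (𝒟.isLinearIn_D g)),
      S.lift_dagger_lift a b (𝒟.isLinearIn_D f) (𝒟.isLinearIn_D g)]
    simp [R, ← Category.assoc]
  R_toUnit A := by
    rw [toUnit_unique (toUnit A) 0,
      S.R_eq 0 (𝒟.D_zero A _) (DiffCombinator.isLinearIn_zero _ _ _), S.dagger_zero]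
  R_comp f g := by
    apply hom_ext_lift
    intro X a b
    rw [R, S.lift_dagger_comp a b f (𝒟.isLinearIn_D f) (𝒟.isLinearIn_D g) _ (𝒟.D_comp f g)]
    simp [R, ← Category.assoc]
  R_linear f := by
    rw [← S.D_eq]
    exact S.isLinearIn_R f
  R_symm {A B} f := by
    rw [← S.D_eq, ← S.D_eq]
    exact 𝒟.ex_D_D f

end ContextualLinearDagger

/-! ### The correspondence -/

/-- A contextual linear dagger is determined by its action on linear maps. -/
lemma sigma_contextualLinearDagger_ext {S T : Σ 𝒟 : DiffCombinator C, ContextualLinearDagger 𝒟}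
    (h : S.1 = T.1)
    (h' : ∀ {I A B : C} (g : I ⊗ A ⟶ B) (hg : S.1.IsLinearIn g) (hg' : T.1.IsLinearIn g),
      S.2.dagger g hg = T.2.dagger g hg') : S = T := by
  obtain ⟨𝒟, S⟩ := S
  obtain ⟨𝒟', T⟩ := T
  obtain rfl : 𝒟 = 𝒟' := h
  congr 1
  have hmap : @S.map = @T.map := by
    funext X Y φ
    apply LinDual.Hom.ext
    · exact (S.map_base φ).trans (T.map_base φ).symm
    · rw [S.map_fib, T.map_fib]
      exact h' _ _ _
  exact ContextualLinearDagger.ext hmap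

/-- The correspondence between reverse differential combinators and differential combinators with
a contextual linear dagger. -/
def reverseEquiv :
    ReverseDiffCombinator C ≃ (Σ 𝒟 : DiffCombinator C, ContextualLinearDagger 𝒟) where
  toFun ℛ := ⟨ℛ.toDiffCombinator, ℛ.toDagger⟩
  invFun S := S.2.toReverseDiffCombinator
  left_inv ℛ := by
    apply ReverseDiffCombinator.ext
    funext A B f
    exact ℛ.transpose_transpose (ℛ.R f) (ℛ.isLinearIn_R f)
  right_inv S := by
    apply sigma_contextualLinearDagger_ext
    · apply DiffCombinator.ext
      funext A B f
      exact (S.2.D_eq f).symm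
    · intro I A B g _ hg
      exact S.2.transpose_R g hg

end RevDiff

theorem mainTheorem1 (C : Type u) [Category.{v} C] [CartesianMonoidalCategory C]
    [CartesianLeftAdditive C] :
    ∃ e : ReverseDiffCombinator C ≃ (Σ 𝒟 : DiffCombinator C, ContextualLinearDagger 𝒟),
      (∀ (ℛ : ReverseDiffCombinator C) {A B : C} (f : A ⟶ B),
        (e ℛ).1.D f = (ι₀ A B ⊗ₘ 𝟙 A) ≫ ℛ.R (ℛ.R f) ≫ snd A B) ∧
      (∀ (ℛ : ReverseDiffCombinator C) {I A B : C} (g : I ⊗ A ⟶ B)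
        (hg : (e ℛ).1.IsLinearIn g),
        (e ℛ).2.dagger g hg = (ι₀ I A ⊗ₘ 𝟙 B) ≫ ℛ.R g ≫ snd I A) ∧
      (∀ (S : Σ 𝒟 : DiffCombinator C, ContextualLinearDagger 𝒟) {A B : C} (f : A ⟶ B),
        ∃ hf : S.1.IsLinearIn (S.1.D f),
          (e.symm S).R f = S.2.dagger (S.1.D f) hf) :=
  ⟨reverseEquiv, fun _ _ _ _ => rfl, fun _ _ _ _ _ _ => rfl,
    fun S _ _ f => ⟨S.1.isLinearIn_D f, rfl⟩⟩
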